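/- There is an absolute constant $\eta_0\in(0,1]$ for which the following holds. Definitions. Let $H$ be a finite graph with open neighbourhoods $N(v)$. For $\tau>0$, a vertex $v$ is called *$\tau$-sparse in $H$* if $N(v)=\emptyset$, or at least $\tau\deg(v)$ neighbours $x$ of $v$ satisfy $|N(v)\,\triangle\,N(x)|\ge\tau\max\{\deg(x),\deg(v)\}$. For a nonempty vertex set $K$, let $\Delta(K)$ be the maximum over $v\in K$ of the degree of $v$ in $H$. The set $K$ is called an *$\varepsilon$-almost-clique of $H$* if every $v\in K$ has at most $\varepsilon\Delta(K)$ non-neighbours inside $K$ (other than $v$ itself) and at most $\varepsilon\Delta(K)$ neighbours outside $K$, and $(1-\varepsilon)\Delta(K)\le|K|\le(1+\varepsilon)\Delta(K)$. Statement. For every $0<\varepsilon<\frac1{64}$ and every integer $c\ge 0$ there is a randomized algorithm (a program for a word RAM with words of $O(\log(n/\varepsilon))$ bits that can draw a uniformly random element of $\{0,\dots,m-1\}$ in one step) with the following guarantee. Let $G=(V,E)$ be any graph with $n\ge 2$ vertices, let $u\in V$, and let $U=N(u)\cup\{u\}$. The algorithm is given $n$ and $u$, and accesses $G$ only through its adjacency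 list, with unit-cost queries for the degree of a vertex, for the $i$-th neighbour of a vertex, and for whether two vertices are adjacent. It always stops after $O\!\left(\frac{|U|\log^2 n}{\varepsilon^2}\right)$ steps. With probability at least $1-n^{-c}$ it outputs a partition of $U$ into a set $V_{\mathrm{sparse}}$ (possibly empty) and sets $K_1,\dots,K_k$ ($k\ge 0$), given by a label for each vertex of $U$, such that 1. every $K_i$ is an $\varepsilon$-almost-clique of the induced subgraph $G[U]$; 2. if $u$ is not $\eta_0\varepsilon$-sparse in $G$, then $u$ belongs to one of the $K_i$. The vertices in $V_{\mathrm{sparse}}$ are not required to be sparse. The constants hidden in the two $O(\cdot)$ depend only on $c$. -/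

import Mathlib

open scoped symmDiff ENNReal

/-! ## Graph notions: closed neighbourhoods, sparse vertices, almost-cliques -/

namespace SDD

section Graph

variable {V : Type*}

/-- The degree of `v` (all graphs considered are finite). -/
noncomputable def deg (G : SimpleGraph V) (v : V) : ℕ := (G.neighborSet v).ncard

/-- The augmented neighbourhood `N[u] = N(u) ∪ {u}`. -/
def closedNbhd (G : SimpleGraph V) (u : V) : Set V := insert u (G.neighborSet u)

/-- `v` is sparse with threshold `τ`: either `N(v) = ∅`, or at least `τ · deg v` neighbours `x` of
`v` satisfy `|N(v) ∆ N(x)| ≥ τ · max (deg x) (deg v)`. -/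
def IsSparse (G : SimpleGraph V) (τ : ℝ) (v : V) : Prop :=
  G.neighborSet v = ∅ ∨
    τ * (deg G v : ℝ) ≤
      (({x | x ∈ G.neighborSet v ∧
        τ * max (deg G x : ℝ) (deg G v : ℝ) ≤
          ((G.neighborSet v ∆ G.neighborSet x).ncard : ℝ)} : Set V).ncard : ℝ)

/-- `Δ(K)`: the maximum degree (counted in the whole graph `H`) of the vertices of `K`. -/
noncomputable def maxDeg (H : SimpleGraph V) (K : Set V) : ℕ := sSup (deg H '' K)

/-- The three properties of an almost-clique `K` in an `ε`-sparse-dense decomposition of `H`. -/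
structure IsAlmostClique (H : SimpleGraph V) (ε : ℝ) (K : Set V) : Prop where
  /-- few non-neighbours inside -/
  nonNeighbors : ∀ v ∈ K,
    (({x | x ∈ K ∧ x ≠ v ∧ ¬ H.Adj v x} : Set V).ncard : ℝ) ≤ ε * (maxDeg H K : ℝ)
  /-- few neighbours outside -/
  neighbors : ∀ v ∈ K,
    (({x | x ∉ K ∧ H.Adj v x} : Set V).ncard : ℝ) ≤ ε * (maxDeg H K : ℝ)
  /-- size at least `(1 - ε) Δ(K)` -/
  size_ge : (1 - ε) * (maxDeg H K : ℝ) ≤ (K.ncard : ℝ)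
  /-- size at most `(1 + ε) Δ(K)` -/
  size_le : (K.ncard : ℝ) ≤ (1 + ε) * (maxDeg H K : ℝ)

end Graph

/-! ## Adjacency-list access to a graph on the vertices `0, …, n - 1` -/

/-- An adjacency list of `G`: for each vertex, its neighbours in an arbitrary order. -/
structure AdjList {n : ℕ} (G : SimpleGraph (Fin n)) where
  nbrs : Fin n → List (Fin n)
  nodup : ∀ v, (nbrs v).Nodup
  mem_iff : ∀ v x, x ∈ nbrs v ↔ G.Adj v x

namespace AdjList

variable {n : ℕ} {G : SimpleGraph (Fin n)}

/-- The row of the machine word `a` (empty if `a` is not the name of a vertex). -/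
def row (L : AdjList G) (a : ℕ) : List ℕ :=
  if h : a < n then (L.nbrs ⟨a, h⟩).map Fin.val else []

/-- Degree query. -/
def degreeQuery (L : AdjList G) (a : ℕ) : ℕ := (L.row a).length

/-- Neighbour query: the `i`-th neighbour of `a` (positions start at `0`), or `0` if there is
none. -/
def neighborQuery (L : AdjList G) (a i : ℕ) : ℕ := (L.row a).getD i 0

/-- Edge query: is there an edge between `a` and `b`? -/
def edgeQuery (L : AdjList G) (a b : ℕ) : ℕ := if b ∈ L.row a then 1 else 0

end AdjList

/-! ## A randomized word RAM with adjacency-list access -/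

/-- The arithmetic operations and comparisons of the machine. -/
inductive BinOp where
  | add | sub | mul | div | mod | lt | eq

/-- The value of an operation, before truncation to a machine word. -/
def BinOp.eval : BinOp → ℕ → ℕ → ℕ
  | .add, x, y => x + y
  | .sub, x, y => x - y
  | .mul, x, y => x * y
  | .div, x, y => x / y
  | .mod, x, y => x % y
  | .lt, x, y => if x < y then 1 else 0
  | .eq, x, y => if x = y then 1 else 0

/-- Programs. The arguments `d`, `a`, `b` are register names; `k` is an immediate constant. -/
inductive Prog where
  | skip
  /-- `d := k` -/
  | const (d k : ℕ)
  /-- `d := a ∘ b` -/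
  | op (o : BinOp) (d a b : ℕ)
  /-- `d := mem[a]` -/
  | load (d a : ℕ)
  /-- `mem[a] := b` -/
  | store (a b : ℕ)
  /-- `d :=` a uniformly random element of `{0, …, a - 1}` (`0` if `a = 0`) -/
  | rand (d a : ℕ)
  /-- `d :=` degree of the vertex `a` -/
  | degree (d a : ℕ)
  /-- `d :=` the `b`-th neighbour of the vertex `a` -/
  | neighbor (d a b : ℕ)
  /-- `d := 1` if `a` and `b` are adjacent, `d := 0` otherwise -/
  | adjacent (d a b : ℕ)
  /-- output: the vertex `a` gets the label `b` -/
  | label (a b : ℕ)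
  /-- sequential composition -/
  | seq (p q : Prog)
  /-- `if a ≠ 0 then p else q` -/
  | cond (a : ℕ) (p q : Prog)
  /-- `while a ≠ 0 do p` -/
  | loop (a : ℕ) (p : Prog)

/-- The registers, the random access memory and the output of the machine. In the output, `none`
means that no label has been written. -/
structure State where
  reg : ℕ → ℕ
  mem : ℕ → ℕ
  out : ℕ → Option ℕ

/-- Write `x` into the register `d`, truncated to `w` bits. -/
def State.set (s : State) (w d x : ℕ) : State :=
  { s with reg := Function.update s.reg d (x % 2 ^ w) }

/-- A uniformly random element of `{0, …, m - 1}` (and `0` if `m = 0`). -/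
noncomputable def uniformBelow : ℕ → PMF ℕ
  | 0 => PMF.pure 0
  | m + 1 => (PMF.uniformOfFintype (Fin (m + 1))).map Fin.val

/-- A configuration: the stack of programs that remain to be executed, and the state. -/
abbrev Config := List Prog × State

section Semantics

variable {n : ℕ} {G : SimpleGraph (Fin n)}

/-- One step of the machine with `w`-bit words and access to the adjacency list `L`.
Every elementary instruction, query, random choice, branching test and unfolding of a sequential
composition is one step; an empty stack means that the machine has halted. -/
noncomputable def step (L : AdjList G) (w : ℕ) : Config → PMF Config
  | ([], s) => PMF.pure ([], s)
  | (.skip :: k, s) => PMF.pure (k, s)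
  | (.const d c :: k, s) => PMF.pure (k, s.set w d c)
  | (.op o d a b :: k, s) => PMF.pure (k, s.set w d (o.eval (s.reg a) (s.reg b)))
  | (.load d a :: k, s) => PMF.pure (k, s.set w d (s.mem (s.reg a)))
  | (.store a b :: k, s) =>
      PMF.pure (k, { s with mem := Function.update s.mem (s.reg a) (s.reg b) })
  | (.rand d a :: k, s) => (uniformBelow (s.reg a)).map fun x => (k, s.set w d x)
  | (.degree d a :: k, s) => PMF.pure (k, s.set w d (L.degreeQuery (s.reg a)))
  | (.neighbor d a b :: k, s) =>
      PMF.pure (k, s.set w d (L.neighborQuery (s.reg a) (s.reg b)))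
  | (.adjacent d a b :: k, s) =>
      PMF.pure (k, s.set w d (L.edgeQuery (s.reg a) (s.reg b)))
  | (.label a b :: k, s) =>
      PMF.pure (k, { s with out := Function.update s.out (s.reg a) (some (s.reg b)) })
  | (.seq p q :: k, s) => PMF.pure (p :: q :: k, s)
  | (.cond a p q :: k, s) => PMF.pure ((if s.reg a ≠ 0 then p else q) :: k, s)
  | (.loop a p :: k, s) =>
      PMF.pure (if s.reg a ≠ 0 then (p :: .loop a p :: k, s) else (k, s))

/-- The distribution of the configuration after `t` steps. -/
noncomputable def run (L : AdjList G) (w : ℕ) : ℕ → Config → PMF Config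
  | 0, c => PMF.pure c
  | t + 1, c => (step L w c).bind (run L w t)

end Semantics

/-- The initial state on a graph with `n` vertices and the fixed vertex `u`: register `0` holds
`n`, register `1` holds `u`; all other registers and the memory are zero, the output is empty. -/
def initState (w n u : ℕ) : State :=
  ((⟨fun _ => 0, fun _ => 0, fun _ => none⟩ : State).set w 0 n).set w 1 u

/-! ## What the output has to be -/

section Output

variable {n : ℕ}

/-- The part of `U` with label `i + 1`, as a set of vertices of `G[U]`. The label `0` stands for
"sparse", and the label `i + 1` for "member of the `i`-th almost-clique". -/
def cliquePart (U : Set (Fin n)) (out : ℕ → Option ℕ) (i : ℕ) : Set U :=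
  {v | out (v : Fin n) = some (i + 1)}

/-- The output is a partition of `U = N[u]`, given by labels of the vertices, into sparse vertices
and almost-cliques of the induced subgraph `G[U]`, in which `u` lies in an almost-clique unless it
is sparse with threshold `η₀ * ε` in `G`. -/
structure IsLocalDecomposition (G : SimpleGraph (Fin n)) (u : Fin n) (η₀ ε : ℝ)
    (out : ℕ → Option ℕ) : Prop where
  /-- exactly the vertices of `U` get a label -/
  labelled : ∀ x : ℕ, out x ≠ none ↔ ∃ v ∈ closedNbhd G u, (v : ℕ) = x
  /-- each (nonempty) almost-clique has the required properties in `G[U]` -/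
  almostClique : ∀ i : ℕ, (cliquePart (closedNbhd G u) out i).Nonempty →
    IsAlmostClique (G.induce (closedNbhd G u)) ε (cliquePart (closedNbhd G u) out i)
  /-- a vertex `u` that is not sparse is in an almost-clique -/
  dense : ¬ IsSparse G (η₀ * ε) u → ∃ i : ℕ, out u = some (i + 1)

end Output

end SDD

/-! A single almost-clique suffices: `u` together with the neighbours `v` of `u` for which `missing
G u v` is small compared with `deg G u`. In `G[N[u]]` the vertex `u` has maximum degree, so `Δ(K) =
deg u` as soon as `u ∈ K`. If all members miss at most `ε deg u` neighbours of `u`, and at most `ε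
deg u` vertices are left out, `K` is an almost-clique (`isAlmostClique_induce`).

For each neighbour, `missing / deg u` is tested on random neighbours of `u`, drawn with replacement.
The test need only separate ratios above `ε` from ratios below `ε / 64`, so `O(log n / ε)` samples
give error `n ^ -(c+1)` (`exists_exponential_bound`), and a union bound over the neighbours leaves
`n ^ -c`. Let `r` be the number of rejected neighbours and `N = ⌈1/ε⌉`. If `N (r + 1) > deg u`,
everything is relabelled sparse; otherwise `r + 1 ≤ ε deg u` and the candidate is valid. When `u` is
not `ε/128`-sparse, correct verdicts reject so few neighbours that the candidate survives
(`mul_succ_le_deg_of_not_isSparse`).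

Running time and error are treated together by `haltExp`, which charges `⊤` to a run that has not
halted. A finite bound therefore shows that all runs halt, and for an error indicator it also bounds
the error probability. Such bounds are propagated backwards through the program, with an exponential
potential in the sampling loop (`haltExp_loop_sample`) and a union-bound potential in the loop over
neighbours (`haltExp_loop_test`). -/

namespace SDD

/-! ### Expected cost at halting, and backward rules for the instructions -/

section Expectation

variable {n : ℕ} {G : SimpleGraph (Fin n)}

/-- The expectation of `f` at the state in which the machine has halted after `T` steps; it is
infinite if the machine may still be running. -/
noncomputable def haltExp (L : AdjList G) (w : ℕ) (f : State → ℝ≥0∞) (T : ℕ) (c : Config) : ℝ≥0∞ :=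
  ∑' x, run L w T c x * (if x.1 = [] then f x.2 else ⊤)

variable {L : AdjList G} {w : ℕ} {f : State → ℝ≥0∞} {T : ℕ} {e : ℝ≥0∞}

theorem haltExp_zero_nil (s : State) : haltExp L w f 0 ([], s) = f s := by
  rw [haltExp, tsum_eq_single (([], s) : Config)]
  · simp [run]
  · intro c hc
    simp [run, hc]

theorem haltExp_succ (c : Config) :
    haltExp L w f (T + 1) c = ∑' c', step L w c c' * haltExp L w f T c' := by
  simp only [haltExp, run, PMF.bind_apply, ← ENNReal.tsum_mul_right, ← ENNReal.tsum_mul_left]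
  rw [ENNReal.tsum_comm]
  simp only [mul_assoc]

theorem haltExp_of_step_eq_pure {c c' : Config} (h : step L w c = PMF.pure c') :
    haltExp L w f (T + 1) c = haltExp L w f T c' := by
  rw [haltExp_succ, h, tsum_eq_single c']
  · simp
  · intro b hb
    simp [hb]

/-- A halted configuration is absorbing, so step budgets only have to be upper bounds. -/
theorem haltExp_nil (s : State) : haltExp L w f T ([], s) = f s := by
  induction T with
  | zero => exact haltExp_zero_nil s
  | succ T ih => rw [haltExp_of_step_eq_pure (c' := ([], s)) rfl, ih]

/-- An unhalted configuration of positive probability would contribute `⊤` to the sum. -/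
theorem halted_of_haltExp_ne_top {c x : Config} (h : haltExp L w f T c ≠ ⊤)
    (hx : x ∈ (run L w T c).support) : x.1 = [] := by
  by_contra hne
  apply h
  rw [eq_top_iff, haltExp]
  refine le_trans ?_ (ENNReal.le_tsum x)
  simp [hne, ENNReal.mul_top ((PMF.mem_support_iff _ _).1 hx)]

open Classical in
theorem toOuterMeasure_le_haltExp (c : Config) (Q : State → Prop) :
    (run L w T c).toOuterMeasure {x | ¬ Q x.2} ≤
      haltExp L w (fun s => if Q s then 0 else 1) T c := by
  rw [PMF.toOuterMeasure_apply, haltExp]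
  refine ENNReal.tsum_le_tsum fun x => ?_
  by_cases hQ : Q x.2
  · simp [hQ]
  · by_cases h : x.1 = []
    · simp [hQ, h]
    · simp only [Set.indicator, Set.mem_ofPred_eq, hQ, not_false_eq_true, if_true, h, if_false]
      exact le_mul_of_one_le_right' le_top

/-- Write `x` into the register `d`, without truncation. -/
def State.put (s : State) (d x : ℕ) : State := { s with reg := Function.update s.reg d x }

theorem State.set_eq_put {s : State} {d x : ℕ} (h : x < 2 ^ w) : s.set w d x = s.put d x := by
  simp [State.set, State.put, Nat.mod_eq_of_lt h]

@[simp] theorem State.put_reg (s : State) (d x r : ℕ) :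
    (s.put d x).reg r = if r = d then x else s.reg r := by
  simp [State.put, Function.update_apply]

@[simp] theorem State.put_out (s : State) (d x : ℕ) : (s.put d x).out = s.out := rfl

/-- Give the vertex `a` the label `b`. -/
def State.mark (s : State) (a b : ℕ) : State :=
  { s with out := Function.update s.out a (some b) }

@[simp] theorem State.mark_reg (s : State) (a b : ℕ) : (s.mark a b).reg = s.reg := rfl

@[simp] theorem State.mark_out (s : State) (a b : ℕ) :
    (s.mark a b).out = Function.update s.out a (some b) := rfl

variable {k : List Prog} {s : State}

/-- The rules from here on are weakest-precondition rules, each paying one step. The side conditions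
`v < 2 ^ w` ensure that no truncation occurs, so the analysis can use exact arithmetic. -/
theorem haltExp_skip (h : haltExp L w f T (k, s) ≤ e) :
    haltExp L w f (T + 1) (.skip :: k, s) ≤ e := by
  rwa [haltExp_of_step_eq_pure rfl]

theorem haltExp_const {d v : ℕ} (hv : v < 2 ^ w) (h : haltExp L w f T (k, s.put d v) ≤ e) :
    haltExp L w f (T + 1) (.const d v :: k, s) ≤ e := by
  rwa [haltExp_of_step_eq_pure rfl, State.set_eq_put hv]

theorem haltExp_op {o : BinOp} {d a b : ℕ} (v : ℕ) (he : o.eval (s.reg a) (s.reg b) = v)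
    (hv : v < 2 ^ w) (h : haltExp L w f T (k, s.put d v) ≤ e) :
    haltExp L w f (T + 1) (.op o d a b :: k, s) ≤ e := by
  subst he
  rwa [haltExp_of_step_eq_pure rfl, State.set_eq_put hv]

theorem haltExp_degree {d a : ℕ} (v : ℕ) (he : L.degreeQuery (s.reg a) = v)
    (hv : v < 2 ^ w) (h : haltExp L w f T (k, s.put d v) ≤ e) :
    haltExp L w f (T + 1) (.degree d a :: k, s) ≤ e := by
  subst he
  rwa [haltExp_of_step_eq_pure rfl, State.set_eq_put hv]

theorem haltExp_neighbor {d a b : ℕ} (v : ℕ) (he : L.neighborQuery (s.reg a) (s.reg b) = v)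
    (hv : v < 2 ^ w) (h : haltExp L w f T (k, s.put d v) ≤ e) :
    haltExp L w f (T + 1) (.neighbor d a b :: k, s) ≤ e := by
  subst he
  rwa [haltExp_of_step_eq_pure rfl, State.set_eq_put hv]

theorem haltExp_adjacent {d a b : ℕ} (v : ℕ) (he : L.edgeQuery (s.reg a) (s.reg b) = v)
    (hv : v < 2 ^ w) (h : haltExp L w f T (k, s.put d v) ≤ e) :
    haltExp L w f (T + 1) (.adjacent d a b :: k, s) ≤ e := by
  subst he
  rwa [haltExp_of_step_eq_pure rfl, State.set_eq_put hv]

theorem haltExp_label {a b : ℕ} (h : haltExp L w f T (k, s.mark (s.reg a) (s.reg b)) ≤ e) :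
    haltExp L w f (T + 1) (.label a b :: k, s) ≤ e := by
  rwa [haltExp_of_step_eq_pure rfl]

theorem haltExp_seq {p q : Prog} (h : haltExp L w f T (p :: q :: k, s) ≤ e) :
    haltExp L w f (T + 1) (.seq p q :: k, s) ≤ e := by
  rwa [haltExp_of_step_eq_pure rfl]

theorem haltExp_cond {a : ℕ} {p q : Prog}
    (hp : s.reg a ≠ 0 → haltExp L w f T (p :: k, s) ≤ e)
    (hq : s.reg a = 0 → haltExp L w f T (q :: k, s) ≤ e) :
    haltExp L w f (T + 1) (.cond a p q :: k, s) ≤ e := by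
  rw [haltExp_of_step_eq_pure rfl]
  by_cases h : s.reg a = 0
  · simpa [h] using hq h
  · simpa [h] using hp h

theorem haltExp_loop_exit {a : ℕ} {p : Prog} (h0 : s.reg a = 0)
    (h : haltExp L w f T (k, s) ≤ e) :
    haltExp L w f (T + 1) (.loop a p :: k, s) ≤ e := by
  rw [haltExp_of_step_eq_pure rfl]
  simpa [h0] using h

theorem haltExp_loop_enter {a : ℕ} {p : Prog} (h0 : s.reg a ≠ 0)
    (h : haltExp L w f T (p :: .loop a p :: k, s) ≤ e) :
    haltExp L w f (T + 1) (.loop a p :: k, s) ≤ e := by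
  rw [haltExp_of_step_eq_pure rfl]
  simpa [h0] using h

theorem tsum_uniformBelow_mul {m : ℕ} (hm : m ≠ 0) (g : ℕ → ℝ≥0∞) :
    ∑' x, uniformBelow m x * g x = (∑ x ∈ Finset.range m, g x) * (m : ℝ≥0∞)⁻¹ := by
  obtain ⟨m, rfl⟩ := Nat.exists_eq_succ_of_ne_zero hm
  have h : ∀ x, uniformBelow (m + 1) x =
      if x ∈ Finset.range (m + 1) then ((m + 1 : ℕ) : ℝ≥0∞)⁻¹ else 0 := by
    intro x
    rw [uniformBelow, PMF.map_apply]
    by_cases hx : x < m + 1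
    · rw [tsum_eq_single (⟨x, hx⟩ : Fin (m + 1))]
      · simp [hx]
      · intro b hb
        rw [if_neg]
        rintro rfl
        exact hb rfl
    · rw [if_neg (by simpa using hx), ENNReal.tsum_eq_zero]
      intro b
      rw [if_neg]
      rintro rfl
      exact hx b.2
  rw [tsum_eq_sum (s := Finset.range (m + 1))]
  · rw [Finset.sum_mul]
    refine Finset.sum_congr rfl fun x hx => ?_
    rw [h, if_pos hx, mul_comm]
  · intro x hx
    rw [h, if_neg hx, zero_mul]

/-- The only rule that averages: a bound depending on the drawn value becomes its mean. Real-valued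
bounds make the mean computable with field arithmetic. -/
theorem haltExp_rand {d a m : ℕ} {g : ℕ → ℝ} (ha : s.reg a = m) (hm : m ≠ 0) (hw : m ≤ 2 ^ w)
    (hg : ∀ x, 0 ≤ g x)
    (h : ∀ x < m, haltExp L w f T (k, s.put d x) ≤ ENNReal.ofReal (g x)) :
    haltExp L w f (T + 1) (.rand d a :: k, s) ≤
      ENNReal.ofReal ((∑ x ∈ Finset.range m, g x) / m) := by
  have hs : step L w (.rand d a :: k, s) = (uniformBelow m).bind
      fun x => PMF.pure ((k, s.set w d x) : Config) := by
    rw [step, ha]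
    rfl
  have h1 : haltExp L w f (T + 1) (.rand d a :: k, s) =
      ∑' x, uniformBelow m x * haltExp L w f T (k, s.set w d x) := by
    rw [haltExp_succ, hs]
    simp only [PMF.bind_apply, ← ENNReal.tsum_mul_right]
    rw [ENNReal.tsum_comm]
    refine tsum_congr fun x => ?_
    rw [tsum_eq_single ((k, s.set w d x) : Config)]
    · simp
    · intro b hb
      simp [hb]
  rw [h1, tsum_uniformBelow_mul hm, div_eq_mul_inv,
    ENNReal.ofReal_mul (Finset.sum_nonneg fun x _ => hg x),
    ENNReal.ofReal_inv_of_pos (by positivity), ENNReal.ofReal_natCast,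
    ENNReal.ofReal_sum_of_nonneg fun x _ => hg x]
  gcongr with x hx
  have hx : x < m := Finset.mem_range.1 hx
  rw [State.set_eq_put (hx.trans_le hw)]
  exact h x hx

end Expectation
-- Almost-cliques around `u` and the effect of correct verdicts
section Decomposition

variable {n : ℕ} {G : SimpleGraph (Fin n)} {u : Fin n}

theorem mem_closedNbhd_iff {v : Fin n} : v ∈ closedNbhd G u ↔ v = u ∨ G.Adj u v := by
  simp [closedNbhd]

theorem ncard_closedNbhd : (closedNbhd G u).ncard = deg G u + 1 := by
  rw [closedNbhd, Set.ncard_insert_of_notMem (by simp) (Set.toFinite _), deg]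

theorem deg_lt (G : SimpleGraph (Fin n)) (u : Fin n) : deg G u < n := by
  have h := Set.ncard_le_ncard (Set.subset_univ (closedNbhd G u)) (Set.toFinite _)
  rw [ncard_closedNbhd, Set.ncard_univ, Nat.card_fin] at h
  exact h

theorem ncard_preimage_val_le {U : Set (Fin n)} (S : Set U) (S' : Set (Fin n))
    (h : ∀ x ∈ S, (x : Fin n) ∈ S') : S.ncard ≤ S'.ncard := by
  rw [← Set.ncard_image_of_injective S Subtype.val_injective]
  refine Set.ncard_le_ncard ?_ (Set.toFinite _)
  rintro _ ⟨x, hx, rfl⟩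
  exact h x hx

theorem deg_induce_le (x : closedNbhd G u) :
    deg (G.induce (closedNbhd G u)) x ≤ deg G u := by
  have h : deg (G.induce (closedNbhd G u)) x < (closedNbhd G u).ncard := by
    rw [deg, ← Set.ncard_image_of_injective _ Subtype.val_injective]
    refine Set.ncard_lt_ncard ⟨?_, ?_⟩ (Set.toFinite _)
    · rintro _ ⟨y, _, rfl⟩
      exact y.2
    · intro hsub
      obtain ⟨y, hy, hyx⟩ := hsub x.2
      have : y = x := Subtype.ext hyx
      subst this
      exact (G.induce (closedNbhd G u)).loopless.irrefl _ hy
  rw [ncard_closedNbhd] at h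
  omega

theorem deg_induce_self (hu : u ∈ closedNbhd G u) :
    deg (G.induce (closedNbhd G u)) ⟨u, hu⟩ = deg G u := by
  rw [deg, ← Set.ncard_image_of_injective _ Subtype.val_injective, deg]
  congr 1
  ext y
  constructor
  · rintro ⟨z, hz, rfl⟩
    exact hz
  · intro hy
    exact ⟨⟨y, mem_closedNbhd_iff.2 (Or.inr hy)⟩, hy, rfl⟩

/-- No vertex of `G[N[u]]` has more than `|N[u]| - 1 = deg u` neighbours there, and `u` attains
this. -/
theorem maxDeg_induce {K : Set (closedNbhd G u)} (hu : u ∈ closedNbhd G u)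
    (hK : ⟨u, hu⟩ ∈ K) : maxDeg (G.induce (closedNbhd G u)) K = deg G u := by
  apply le_antisymm
  · refine csSup_le ⟨_, _, hK, rfl⟩ ?_
    rintro _ ⟨x, _, rfl⟩
    exact deg_induce_le x
  · refine le_csSup ⟨deg G u, ?_⟩ ⟨_, hK, deg_induce_self hu⟩
    rintro _ ⟨x, _, rfl⟩
    exact deg_induce_le x

/-- The number of neighbours of `u` that are not neighbours of `v`. -/
noncomputable def missing (G : SimpleGraph (Fin n)) (u v : Fin n) : ℕ :=
  ({y | G.Adj u y ∧ ¬ G.Adj v y} : Set (Fin n)).ncard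

/-- A set containing `u`, all but few of the neighbours of `u`, and only vertices adjacent to
almost all neighbours of `u`, is an almost-clique of `G[N[u]]`. -/
theorem isAlmostClique_induce {ε : ℝ} {K : Set (closedNbhd G u)} (hu : u ∈ closedNbhd G u)
    (hK : ⟨u, hu⟩ ∈ K)
    (hin : ∀ v ∈ K, (v : Fin n) ≠ u → (missing G u v : ℝ) ≤ ε * deg G u)
    (hout : ((Kᶜ).ncard : ℝ) ≤ ε * deg G u) (hd : 1 ≤ ε * deg G u) :
    IsAlmostClique (G.induce (closedNbhd G u)) ε K := by
  have hcard : K.ncard + (Kᶜ).ncard = deg G u + 1 := by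
    rw [Set.ncard_add_ncard_compl, ← ncard_closedNbhd (G := G)]
    exact Nat.card_coe_set_eq _
  have hcardR : (K.ncard : ℝ) + (Kᶜ).ncard = deg G u + 1 := by exact_mod_cast hcard
  refine ⟨fun v hv => ?_, fun v hv => ?_, ?_, ?_⟩
  · rw [maxDeg_induce hu hK]
    by_cases hvu : (v : Fin n) = u
    · have : ({x | x ∈ K ∧ x ≠ v ∧ ¬ (G.induce (closedNbhd G u)).Adj v x} :
          Set (closedNbhd G u)) = ∅ := by
        ext x
        simp only [Set.mem_ofPred_eq, Set.mem_empty_iff_false, iff_false, not_and, not_not]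
        intro _ hxv
        rw [SimpleGraph.comap_adj]
        simp only [Function.Embedding.subtype_apply, hvu]
        refine (mem_closedNbhd_iff.1 x.2).resolve_left fun h => hxv (Subtype.ext (h.trans hvu.symm))
      rw [this, Set.ncard_empty, Nat.cast_zero]
      linarith
    · refine le_trans ?_ (hin v hv hvu)
      rw [Nat.cast_le]
      refine (Set.ncard_le_ncard (t := {x : closedNbhd G u | G.Adj u x ∧ ¬ G.Adj v x}) ?_
        (Set.toFinite _)).trans (ncard_preimage_val_le _ _ fun x hx => hx)
      -- A non-neighbour `x` of `v` cannot be `u`, since `v ≠ u` lies in `N[u]`; hence `x` is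
      -- counted by `missing`.
      rintro x ⟨_, hxv, hadj⟩
      refine ⟨(mem_closedNbhd_iff.1 x.2).resolve_left fun h => hadj ?_, hadj⟩
      change G.Adj v x
      rw [h]
      exact ((mem_closedNbhd_iff.1 v.2).resolve_left hvu).symm
  · rw [maxDeg_induce hu hK]
    refine le_trans ?_ hout
    rw [Nat.cast_le]
    exact Set.ncard_le_ncard (fun x hx => hx.1) (Set.toFinite _)
  · rw [maxDeg_induce hu hK]
    linarith
  -- `K` may have `deg u + 1` elements; the hypothesis `1 ≤ ε * deg G u` absorbs the extra one.
  · rw [maxDeg_induce hu hK]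
    have : (0 : ℝ) ≤ (Kᶜ).ncard := Nat.cast_nonneg _
    linarith

/-- With `D` the size of the symmetric difference, both degrees are at most `deg u + D`. Hence `D <
τ (deg u + D)`, and `τ ≤ 1/2` allows solving for `D`. -/
theorem missing_le_of_ncard_symmDiff_lt {τ : ℝ} {x : Fin n} (hτ0 : 0 ≤ τ) (hτ : τ ≤ 1 / 2)
    (h : ((G.neighborSet u ∆ G.neighborSet x).ncard : ℝ) <
      τ * max (deg G x : ℝ) (deg G u : ℝ)) : (missing G u x : ℝ) < 2 * τ * deg G u := by
  set D := (G.neighborSet u ∆ G.neighborSet x).ncard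
  have h1 : missing G u x ≤ D :=
    Set.ncard_le_ncard (fun y hy => Or.inl ⟨hy.1, hy.2⟩) (Set.toFinite _)
  have h2 : deg G x ≤ deg G u + D := by
    refine (Set.ncard_le_ncard ?_ (Set.toFinite _)).trans (Set.ncard_union_le _ _)
    intro y hy
    by_cases hyu : y ∈ G.neighborSet u
    · exact Or.inl hyu
    · exact Or.inr (Or.inr ⟨hy, hyu⟩)
  have h1' : (missing G u x : ℝ) ≤ D := by exact_mod_cast h1
  have h2' : (deg G x : ℝ) ≤ deg G u + D := by exact_mod_cast h2
  have hD : (0 : ℝ) ≤ D := Nat.cast_nonneg _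
  have hm : max (deg G x : ℝ) (deg G u : ℝ) ≤ deg G u + D := max_le h2' (by linarith)
  have h3 : (D : ℝ) < τ * (deg G u + D) := h.trans_le (mul_le_mul_of_nonneg_left hm hτ0)
  have h4 : τ * D ≤ 1 / 2 * D := mul_le_mul_of_nonneg_right hτ hD
  linarith

theorem missing_self_pos {x : Fin n} (hx : G.Adj u x) : 1 ≤ missing G u x := by
  exact (Set.ncard_pos (Set.toFinite _)).2 ⟨x, hx, G.loopless.irrefl x⟩

/-- If `u` is not sparse, few neighbours of `u` miss many neighbours of `u`. -/
theorem ncard_missing_lt_of_not_isSparse {τ : ℝ} (hτ0 : 0 < τ) (hτ : τ ≤ 1 / 2)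
    (h : ¬ IsSparse G τ u) :
    (({x | G.Adj u x ∧ 2 * τ * deg G u ≤ (missing G u x : ℝ)} : Set (Fin n)).ncard : ℝ) <
      τ * deg G u ∧ 1 < 2 * τ * deg G u := by
  rw [IsSparse, not_or, not_le] at h
  obtain ⟨hne, hlt⟩ := h
  have hpos : (0 : ℝ) < deg G u := by
    rw [Nat.cast_pos, deg, Set.ncard_pos (Set.toFinite _)]
    exact Set.nonempty_iff_ne_empty.2 hne
  refine ⟨lt_of_le_of_lt ?_ hlt, ?_⟩
  · rw [Nat.cast_le]
    refine Set.ncard_le_ncard ?_ (Set.toFinite _)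
    rintro x ⟨hx, hxm⟩
    refine ⟨hx, ?_⟩
    by_contra hcon
    exact (missing_le_of_ncard_symmDiff_lt hτ0.le hτ (not_le.1 hcon)).not_ge hxm
  -- If `2 τ deg u ≤ 1`, a neighbour `x` with small symmetric difference would have `missing < 1`,
  -- although `x` itself is counted in `missing`. So every neighbour witnesses sparsity, and `u`
  -- would be sparse.
  · by_contra hcon
    refine hlt.not_ge ?_
    have : ({x | x ∈ G.neighborSet u ∧ τ * max (deg G x : ℝ) (deg G u : ℝ) ≤
        ((G.neighborSet u ∆ G.neighborSet x).ncard : ℝ)} : Set (Fin n)) = G.neighborSet u := by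
      refine Set.Subset.antisymm (fun x hx => hx.1) fun x hx => ⟨hx, ?_⟩
      by_contra hx'
      have h1 := missing_le_of_ncard_symmDiff_lt hτ0.le hτ (not_le.1 hx')
      have h2 : (1 : ℝ) ≤ missing G u x := by exact_mod_cast missing_self_pos hx
      linarith
    rw [this]
    change τ * deg G u ≤ deg G u
    nlinarith

/-- Exactly the vertices of `S` are labelled, with `0` or `1`, and `r` of them with `0`. -/
structure IsLabelling (S : Set (Fin n)) (out : ℕ → Option ℕ) (r : ℕ) : Prop where
  mem : ∀ v ∈ S, out v = some 0 ∨ out v = some 1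
  notMem : ∀ a : ℕ, (∀ v ∈ S, (v : ℕ) ≠ a) → out a = none
  count : ({v | v ∈ S ∧ out v = some 0} : Set (Fin n)).ncard = r

theorem IsLabelling.insert {S : Set (Fin n)} {out : ℕ → Option ℕ} {r : ℕ}
    (h : IsLabelling S out r) {x : Fin n} (hx : x ∉ S) {b : ℕ} (hb : b = 0 ∨ b = 1) :
    IsLabelling (insert x S) (Function.update out x (some b)) (r + (1 - b)) := by
  have hne : ∀ v ∈ S, (v : ℕ) ≠ x := fun v hv hvx => hx (Fin.ext hvx ▸ hv)
  refine ⟨?_, fun a ha => ?_, ?_⟩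
  · rintro v (rfl | hv)
    · rcases hb with rfl | rfl <;> simp
    · rw [Function.update_of_ne (hne v hv)]
      exact h.mem v hv
  · rw [Function.update_of_ne (ha x (Set.mem_insert x S)).symm]
    exact h.notMem a fun v hv => ha v (Set.mem_insert_of_mem x hv)
  · rw [← h.count]
    have hS : ({v | v ∈ S ∧ Function.update out x (some b) (v : ℕ) = some 0} : Set (Fin n)) =
        {v | v ∈ S ∧ out v = some 0} := by
      ext v
      exact and_congr_right fun hv => by rw [Function.update_of_ne (hne v hv)]
    rcases hb with rfl | rfl
    · rw [← Set.ncard_insert_of_notMem (a := x) (fun hx' => hx hx'.1) (Set.toFinite _), ← hS]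
      congr 1
      ext v
      constructor
      · rintro ⟨rfl | hv, h0⟩
        · exact Or.inl rfl
        · exact Or.inr ⟨hv, h0⟩
      · rintro (rfl | hv)
        · exact ⟨Or.inl rfl, by simp⟩
        · exact ⟨Or.inr hv.1, hv.2⟩
    · rw [Nat.sub_self, Nat.add_zero, ← hS]
      congr 1
      ext v
      constructor
      · rintro ⟨rfl | hv, h0⟩
        · simp at h0
        · exact ⟨hv, h0⟩
      · exact fun hv => ⟨Or.inr hv.1, hv.2⟩

/-- The labelled verdicts are correct about `v`. -/
def VerdictOK (G : SimpleGraph (Fin n)) (u : Fin n) (ε : ℝ) (out : ℕ → Option ℕ) (v : Fin n) :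
    Prop :=
  (out v = some 1 → (missing G u v : ℝ) ≤ ε * deg G u) ∧
    (out v = some 0 → ε / 64 * deg G u ≤ (missing G u v : ℝ))

theorem isLocalDecomposition_zero {η₀ ε : ℝ} {out : ℕ → Option ℕ}
    (hlab : ∀ x : ℕ, out x ≠ none ↔ ∃ v ∈ closedNbhd G u, (v : ℕ) = x)
    (h0 : ∀ x i, out x = some i → i = 0) (hs : IsSparse G (η₀ * ε) u) :
    IsLocalDecomposition G u η₀ ε out := by
  refine ⟨hlab, ?_, fun h => absurd hs h⟩
  rintro i ⟨v, hv⟩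
  exact absurd (h0 _ _ hv) (Nat.succ_ne_zero i)

/-- The acceptance condition `N (r + 1) ≤ deg u` with `1 ≤ ε N` yields `r + 1 ≤ ε deg u`. This
bounds the vertices left out and also gives `1 ≤ ε deg u`. -/
theorem isLocalDecomposition_one {η₀ ε : ℝ} {out : ℕ → Option ℕ} {r N : ℕ}
    (hl : IsLabelling (G.neighborSet u) out r)
    (hok : ∀ v ∈ G.neighborSet u, VerdictOK G u ε out v)
    (hε : 0 < ε) (hN : 1 ≤ ε * N) (hd : N * (r + 1) ≤ deg G u) :
    IsLocalDecomposition G u η₀ ε (Function.update out u (some 1)) := by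
  have hu : u ∈ closedNbhd G u := mem_closedNbhd_iff.2 (Or.inl rfl)
  have hne : ∀ v, G.Adj u v → (v : ℕ) ≠ u := fun v hv h => hv.ne (Fin.ext h).symm
  have hdR : (N : ℝ) * (r + 1) ≤ deg G u := by exact_mod_cast hd
  have hr1 : (r : ℝ) + 1 ≤ ε * deg G u := by
    have : 0 ≤ (r : ℝ) + 1 := by positivity
    nlinarith
  have hr0 : (0 : ℝ) ≤ r := Nat.cast_nonneg r
  refine ⟨fun x => ⟨fun hx => ?_, ?_⟩, fun i hi => ?_, fun _ => ⟨0, by simp⟩⟩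
  · by_contra hcon
    push Not at hcon
    apply hx
    rw [Function.update_of_ne (hcon u hu).symm]
    exact hl.notMem x fun v hv => hcon v (mem_closedNbhd_iff.2 (Or.inr hv))
  · rintro ⟨v, hv, rfl⟩
    rcases mem_closedNbhd_iff.1 hv with rfl | hv
    · simp
    · rw [Function.update_of_ne (hne v hv)]
      rcases hl.mem v hv with h | h <;> simp [h]
  · obtain rfl : i = 0 := by
      obtain ⟨v, hv⟩ := hi
      rw [cliquePart, Set.mem_ofPred_eq] at hv
      rcases mem_closedNbhd_iff.1 v.2 with h | h
      · simpa [h] using hv.symm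
      · rw [Function.update_of_ne (hne _ h)] at hv
        rcases hl.mem _ h with h' | h' <;> rw [h'] at hv <;> simpa using hv.symm
    refine isAlmostClique_induce hu (by simp [cliquePart]) ?_ ?_ (by linarith)
    · intro v hv hvu
      have hadj := (mem_closedNbhd_iff.1 v.2).resolve_left hvu
      rw [cliquePart, Set.mem_ofPred_eq, Function.update_of_ne (hne _ hadj)] at hv
      exact (hok v hadj).1 hv
    · have : ((cliquePart (closedNbhd G u) (Function.update out u (some 1)) 0)ᶜ).ncard ≤ r := by
        rw [← hl.count]
        refine ncard_preimage_val_le _ _ fun x hx => ?_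
        rw [cliquePart, Set.mem_compl_iff, Set.mem_ofPred_eq] at hx
        have hxu : (x : Fin n) ≠ u := by
          intro h
          simp [h] at hx
        have hadj := (mem_closedNbhd_iff.1 x.2).resolve_left hxu
        rw [Function.update_of_ne (hne _ hadj)] at hx
        exact ⟨hadj, (hl.mem _ hadj).resolve_right hx⟩
      have : (((cliquePart (closedNbhd G u) (Function.update out u (some 1)) 0)ᶜ).ncard : ℝ) ≤ r :=
        by exact_mod_cast this
      linarith

/-- If `u` is not sparse, only few neighbours of `u` are rejected by correct verdicts. -/
theorem mul_succ_le_deg_of_not_isSparse {ε : ℝ} {out : ℕ → Option ℕ} {r N : ℕ}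
    (hl : IsLabelling (G.neighborSet u) out r)
    (hok : ∀ v ∈ G.neighborSet u, VerdictOK G u ε out v)
    (hε : 0 < ε) (hε1 : ε < 1 / 64) (hN : ε * N ≤ 2) (hs : ¬ IsSparse G (1 / 128 * ε) u) :
    N * (r + 1) ≤ deg G u := by
  obtain ⟨h1, h2⟩ := ncard_missing_lt_of_not_isSparse (by positivity) (by linarith) hs
  have h3 : r ≤ ({x | G.Adj u x ∧ 2 * (1 / 128 * ε) * deg G u ≤ (missing G u x : ℝ)} :
      Set (Fin n)).ncard := by
    rw [← hl.count]
    refine Set.ncard_le_ncard (fun v hv => ⟨hv.1, ?_⟩) (Set.toFinite _)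
    have := (hok v hv.1).2 hv.2
    linarith
  have h3' : (r : ℝ) ≤ (({x | G.Adj u x ∧ 2 * (1 / 128 * ε) * deg G u ≤ (missing G u x : ℝ)} :
      Set (Fin n)).ncard : ℝ) := by exact_mod_cast h3
  -- With `τ = ε/128`: `r < τ deg u` and `1 < 2 τ deg u`, which add up to `3 τ deg u`.
  have h4 : (r : ℝ) + 1 ≤ 3 / 128 * ε * deg G u := by linarith
  have h5 : (N : ℝ) * (r + 1) ≤ deg G u := by
    have hNn : (0 : ℝ) ≤ N := Nat.cast_nonneg N
    have hdn : (0 : ℝ) ≤ deg G u := Nat.cast_nonneg _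
    calc (N : ℝ) * (r + 1) ≤ N * (3 / 128 * ε * deg G u) := mul_le_mul_of_nonneg_left h4 hNn
      _ = 3 / 128 * (ε * N) * deg G u := by ring
      _ ≤ 3 / 128 * 2 * deg G u := by gcongr
      _ ≤ deg G u := by linarith
  exact_mod_cast h5

end Decomposition
-- Queries in terms of the graph, and averages over random neighbours
section Queries

variable {n : ℕ} {G : SimpleGraph (Fin n)} (L : AdjList G)

theorem AdjList.row_val (v : Fin n) : L.row v = (L.nbrs v).map Fin.val := by
  simp [AdjList.row]

theorem AdjList.length_nbrs (v : Fin n) : (L.nbrs v).length = deg G v := by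
  rw [← List.toFinset_card_of_nodup (L.nodup v), deg, ← Set.ncard_coe_finset]
  congr 1
  ext x
  simp [L.mem_iff]

theorem AdjList.degreeQuery_val (v : Fin n) : L.degreeQuery v = deg G v := by
  rw [AdjList.degreeQuery, L.row_val, List.length_map, L.length_nbrs]

theorem AdjList.neighborQuery_val (v : Fin n) {i : ℕ} (hi : i < (L.nbrs v).length) :
    L.neighborQuery v i = (L.nbrs v)[i] := by
  rw [AdjList.neighborQuery, L.row_val, List.getD_eq_getElem _ _ (by simpa using hi),
    List.getElem_map]

open Classical in
theorem AdjList.edgeQuery_val (v x : Fin n) :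
    L.edgeQuery v x = if G.Adj v x then 1 else 0 := by
  rw [AdjList.edgeQuery, L.row_val]
  simp [Fin.val_inj, L.mem_iff]

open Classical in
theorem AdjList.sum_neighborQuery (v : Fin n) (h : ℕ → ℝ) :
    ∑ b ∈ Finset.range (deg G v), h (L.neighborQuery v b) = ∑ y with G.Adj v y, h y := by
  rw [← L.length_nbrs]
  refine Finset.sum_bij (fun b hb => (L.nbrs v)[b]'(Finset.mem_range.1 hb)) ?_ ?_ ?_ ?_
  · intro b hb
    simp [← L.mem_iff]
  · intro a ha b hb hab
    exact (L.nodup v).getElem_inj_iff.1 hab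
  · intro y hy
    obtain ⟨i, hi, rfl⟩ := List.getElem_of_mem ((L.mem_iff v y).2 (by simpa using hy))
    exact ⟨i, Finset.mem_range.2 hi, rfl⟩
  · intro b hb
    rw [L.neighborQuery_val v (Finset.mem_range.1 hb)]

theorem card_filter_adj [DecidableRel G.Adj] (u : Fin n) :
    (Finset.univ.filter fun y => G.Adj u y).card = deg G u := by
  rw [deg, ← Set.ncard_coe_finset]
  congr 1
  ext x
  simp

open Classical in
/-- The average over the neighbours `y` of `u` of a quantity that only depends on whether `y` is
a neighbour of `x`. -/
theorem AdjList.sum_edgeQuery (u x : Fin n) (h : ℕ → ℝ) :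
    ∑ b ∈ Finset.range (deg G u), h (L.edgeQuery x (L.neighborQuery u b)) =
      missing G u x * h 0 + (deg G u - missing G u x) * h 1 := by
  rw [L.sum_neighborQuery u fun a => h (L.edgeQuery x a)]
  simp only [L.edgeQuery_val]
  rw [← Finset.sum_filter_add_sum_filter_not _ (fun y => G.Adj x y)]
  have h1 : ((Finset.univ.filter fun y => G.Adj u y).filter fun y => ¬ G.Adj x y).card =
      missing G u x := by
    rw [missing, ← Set.ncard_coe_finset]
    congr 1
    ext y
    simp
  have h2 := Finset.card_filter_add_card_filter_not (s := Finset.univ.filter fun y => G.Adj u y)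
    (fun y => G.Adj x y)
  rw [h1, card_filter_adj] at h2
  have h2' : ((((Finset.univ.filter fun y => G.Adj u y).filter fun y => G.Adj x y).card : ℕ) : ℝ)
      = deg G u - missing G u x := by
    rw [← h2]
    push_cast
    ring
  rw [Finset.sum_eq_card_nsmul (b := h 1), Finset.sum_eq_card_nsmul (b := h 0),
    nsmul_eq_mul, nsmul_eq_mul, h1, h2', add_comm]
  · intro y hy
    rw [if_neg (Finset.mem_filter.1 hy).2]
  · intro y hy
    rw [if_pos (Finset.mem_filter.1 hy).2]

theorem missing_le_deg (u x : Fin n) : missing G u x ≤ deg G u :=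
  Set.ncard_le_ncard (fun _ hy => hy.1) (Set.toFinite _)

end Queries

/-! ### Chernoff-type bound for the threshold test -/

section Tail

/-- A threshold test on the number of non-neighbours among `8 N k` random neighbours of `u` errs
with small probability: the indicator of an error is dominated by an exponential function `A g ^ t`
of the number `t` of non-neighbours, and the mean of that function is small. -/
theorem exists_exponential_bound {ε q : ℝ} {N c l n : ℕ} (hε : 0 < ε) (hN1 : 1 ≤ ε * N)
    (hN2 : ε * N ≤ 2) (hq0 : 0 ≤ q) (hq1 : q ≤ 1) (hl : n ≤ 2 ^ l) (hn : 0 < n) :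
    ∃ A g ρ : ℝ, 0 ≤ A ∧ 0 ≤ g ∧ 0 ≤ ρ ∧ q * g + (1 - q) ≤ ρ ∧
      A * ρ ^ (8 * N * (2 * (c + 1) * l)) ≤ 1 / (n : ℝ) ^ (c + 1) ∧
      ∀ t : ℕ, (t < 2 * (c + 1) * l ∧ ε < q ∨ 2 * (c + 1) * l ≤ t ∧ q < ε / 64) →
        1 ≤ A * g ^ t := by
  have hNn : (0 : ℝ) ≤ N := Nat.cast_nonneg N
  have hfin : ((1 / 2 : ℝ) ^ ((c + 1) * l)) ≤ 1 / (n : ℝ) ^ (c + 1) := by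
    rw [one_div_pow]
    apply one_div_le_one_div_of_le (by positivity)
    calc (n : ℝ) ^ (c + 1) ≤ ((2 : ℝ) ^ l) ^ (c + 1) := by
          gcongr
          exact_mod_cast hl
      _ = 2 ^ ((c + 1) * l) := by rw [← pow_mul, mul_comm]
  by_cases hA : ε < q
  -- The error is a count below the threshold, so the dominating function decreases in `t`. Each
  -- block of `8 N` samples contributes a factor at most `1/4`, against the factor `2` per unit of
  -- threshold in `A`.
  · refine ⟨2 ^ (2 * (c + 1) * l), 1 / 2, 1 - q / 2, by positivity, by positivity, by linarith,
      by linarith, ?_, ?_⟩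
    -- An upper bound on a power of `1 - x` comes from Bernoulli for `1 + x` and `(1 - x)(1 + x) ≤
    -- 1`.
    · have hb : (1 - q / 2) ^ (8 * N) ≤ 1 / 4 := by
        have h1 : 1 + ((8 * N : ℕ) : ℝ) * (q / 2) ≤ (1 + q / 2) ^ (8 * N) :=
          one_add_mul_le_pow (by linarith) _
        have h2 : (1 - q / 2) ^ (8 * N) * (1 + q / 2) ^ (8 * N) ≤ 1 := by
          rw [← mul_pow]
          exact pow_le_one₀ (by nlinarith) (by nlinarith)
        have h3 : (4 : ℝ) ≤ 1 + ((8 * N : ℕ) : ℝ) * (q / 2) := by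
          push_cast
          nlinarith
        have h4 : (0 : ℝ) ≤ (1 - q / 2) ^ (8 * N) := pow_nonneg (by linarith) _
        nlinarith
      refine le_trans ?_ hfin
      rw [pow_mul (1 - q / 2), ← mul_pow]
      have h4 : (0 : ℝ) ≤ (1 - q / 2) ^ (8 * N) := pow_nonneg (by linarith) _
      calc (2 * (1 - q / 2) ^ (8 * N)) ^ (2 * (c + 1) * l) ≤ (1 / 2) ^ (2 * (c + 1) * l) := by
            gcongr
            linarith
        _ ≤ (1 / 2) ^ ((c + 1) * l) :=
            pow_le_pow_of_le_one (by norm_num) (by norm_num) (by nlinarith)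
    · rintro t (⟨ht, _⟩ | ⟨_, h⟩)
      · calc (1 : ℝ) = 2 ^ t * (1 / 2) ^ t := by rw [← mul_pow]; norm_num
          _ ≤ 2 ^ (2 * (c + 1) * l) * (1 / 2) ^ t := by
            gcongr
            norm_num
      · linarith
  · by_cases hB : q < ε / 64
    -- Now the error is a large count. Since `16 N q ≤ 1/2`, two blocks of `8 N` samples together
    -- cost at most `2`, against `1/4` from `A`. Each pair gains `1/2`, which is why the threshold
    -- carries the factor `2` in `2 (c + 1) l`.
    · refine ⟨(1 / 2) ^ (2 * (c + 1) * l), 2, 1 + q, by positivity, by positivity, by linarith,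
        by linarith, ?_, ?_⟩
      · have hb : ((1 + q) ^ (8 * N)) ^ 2 ≤ 2 := by
          rw [← pow_mul]
          have h1 : 1 + ((8 * N * 2 : ℕ) : ℝ) * (-q) ≤ (1 + -q) ^ (8 * N * 2) :=
            one_add_mul_le_pow (by linarith) _
          have h2 : (1 + q) ^ (8 * N * 2) * (1 + -q) ^ (8 * N * 2) ≤ 1 := by
            rw [← mul_pow]
            exact pow_le_one₀ (by nlinarith) (by nlinarith)
          have h3 : (1 : ℝ) / 2 ≤ 1 + ((8 * N * 2 : ℕ) : ℝ) * (-q) := by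
            push_cast
            nlinarith
          have h4 : (0 : ℝ) ≤ (1 + q) ^ (8 * N * 2) := pow_nonneg (by linarith) _
          nlinarith
        refine le_trans (le_of_eq ?_) (le_trans 
          (pow_le_pow_left₀ (a := 1 / 4 * ((1 + q) ^ (8 * N)) ^ 2) (b := 1 / 2) ?_ ?_ _) hfin)
        · rw [pow_mul (1 + q), mul_assoc 2 (c + 1) l, pow_mul, pow_mul ((1 + q) ^ (8 * N)),
            ← mul_pow]
          norm_num
        · positivity
        · linarith
      · rintro t (⟨_, h⟩ | ⟨ht, _⟩)
        · linarith
        · calc (1 : ℝ) = (1 / 2) ^ (2 * (c + 1) * l) * 2 ^ (2 * (c + 1) * l) := by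
                rw [← mul_pow]; norm_num
            _ ≤ (1 / 2) ^ (2 * (c + 1) * l) * 2 ^ t := by
              gcongr
              norm_num
    -- For `ε / 64 ≤ q ≤ ε` either verdict is correct, so there is no error to dominate.
    · refine ⟨0, 1, 1, le_rfl, by norm_num, by norm_num, by linarith, ?_, ?_⟩
      · rw [zero_mul]
        positivity
      · rintro t (⟨_, h⟩ | ⟨_, h⟩)
        · exact absurd h hA
        · exact absurd h hB

end Tail
-- The program and the analysis of its loops
section Program

/-- Execute the programs of a list one after the other. -/
def block : List Prog → Prog
  | [] => .skip
  | p :: ps => .seq p (block ps)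

/-- Count (in register `12`) the non-neighbours of the vertex in register `8` among random
neighbours of `u`; the number of samples is in register `9`. -/
def sampleBody : Prog := block
  [.op .sub 9 9 5, .rand 15 2, .neighbor 16 1 15, .adjacent 17 8 16, .op .sub 17 5 17,
    .op .add 12 12 17]

/-- Label the next neighbour of `u` by a threshold test on the sampled non-neighbours. -/
def testBody : Prog := block
  [.op .sub 7 7 5, .neighbor 8 1 7, .const 12 0, .op .add 9 13 18, .loop 9 sampleBody,
    .op .lt 17 12 14, .label 8 17, .op .sub 17 5 17, .op .add 10 10 17]

/-- Label the next neighbour of `u` by `0`. -/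
def clearBody : Prog := block [.op .sub 7 7 5, .neighbor 8 1 7, .label 8 18]

/-- Label `u` and all its neighbours by `0`. -/
def clear : Prog := block [.label 1 18, .op .add 7 2 18, .loop 7 clearBody]

/-- Label `u` by `1`, and discard the almost-clique if too many neighbours of `u` have been
rejected. -/
def finish (N : ℕ) : Prog := block
  [.label 1 5, .const 11 N, .op .add 10 10 5, .op .mul 10 10 11, .op .lt 17 2 10,
    .cond 17 clear .skip]

/-- Remove the last binary digit of register `4`, and count it in register `3`. -/
def digitsBody : Prog := block [.op .div 4 4 6, .op .add 3 3 5]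

/-- The whole algorithm; the test takes `8 * N * K * l` samples with threshold `K * l`, where `l`
is the number of binary digits of `n`. -/
def localDecomposition (N K : ℕ) : Prog := .seq (block
  [.const 5 1, .const 6 2, .degree 2 1, .op .add 4 0 18, .loop 4 digitsBody,
    .const 11 (8 * N * K), .op .mul 13 11 3, .const 11 K, .op .mul 14 11 3, .op .add 7 2 18,
    .loop 7 testBody]) (finish N)

variable {n : ℕ} {G : SimpleGraph (Fin n)} {L : AdjList G} {w : ℕ} {f : State → ℝ≥0∞} {T : ℕ}
  {k : List Prog} {u : Fin n} {N m t : ℕ}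

/-- The registers that are constant during the main loop have the intended values. -/
structure State.Ready (s : State) (G : SimpleGraph (Fin n)) (u : Fin n) (m t : ℕ) : Prop where
  r1 : s.reg 1 = u
  r2 : s.reg 2 = deg G u
  r5 : s.reg 5 = 1
  r13 : s.reg 13 = m
  r14 : s.reg 14 = t
  r18 : s.reg 18 = 0

theorem edgeQuery_le_one (L : AdjList G) (a b : ℕ) : L.edgeQuery a b ≤ 1 := by
  unfold AdjList.edgeQuery
  split_ifs <;> omega

theorem neighborQuery_lt (L : AdjList G) (a i : ℕ) (hn : 0 < n) : L.neighborQuery a i < n := by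
  rw [AdjList.neighborQuery, AdjList.row]
  split_ifs with h
  · by_cases hi : i < ((L.nbrs ⟨a, h⟩).map Fin.val).length
    · rw [List.getD_eq_getElem _ _ hi, List.getElem_map]
      exact Fin.is_lt _
    · rw [List.getD_eq_default _ _ (not_lt.1 hi)]
      exact hn
  · simpa using hn

/-- The potential is `A ρ ^ j g ^ cnt + B`, with `j` samples left: one sample multiplies `g ^ cnt`
on average by `q g + (1 - q) ≤ ρ`, where `q` is the proportion of non-neighbours of `x`. The summand
`B` carries the error already charged elsewhere. The invariant `j + cnt ≤ m` keeps the counter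
within a word. -/
theorem haltExp_loop_sample {x : Fin n} {i r : ℕ} {o : ℕ → Option ℕ} {A g ρ B : ℝ}
    (hA : 0 ≤ A) (hg : 0 ≤ g) (hρ : 0 ≤ ρ) (hB : 0 ≤ B)
    (hm : m < 2 ^ w) (hn : n < 2 ^ w) (hd : deg G u ≠ 0)
    (hmean : (missing G u x : ℝ) / deg G u * g + (1 - (missing G u x : ℝ) / deg G u) ≤ ρ)
    (hpost : ∀ (s : State) (cnt : ℕ), s.Ready G u m t → s.reg 7 = i → s.reg 8 = x →
      s.reg 10 = r → s.out = o → s.reg 12 = cnt →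
      haltExp L w f T (k, s) ≤ ENNReal.ofReal (A * g ^ cnt + B)) (j : ℕ) :
    ∀ (s : State) (cnt : ℕ), j + cnt ≤ m → s.Ready G u m t → s.reg 7 = i → s.reg 8 = x →
      s.reg 10 = r → s.out = o → s.reg 12 = cnt → s.reg 9 = j →
      haltExp L w f (T + 1 + 14 * j) (.loop 9 sampleBody :: k, s) ≤
        ENNReal.ofReal (A * ρ ^ j * g ^ cnt + B) := by
  have hn0 : 0 < n := x.pos
  have h1w : 1 < 2 ^ w := by omega
  induction j with
  | zero =>
    intro s cnt _ hs h7 h8 h10 ho h12 h9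
    refine haltExp_loop_exit h9 ?_
    simpa using hpost s cnt hs h7 h8 h10 ho h12
  | succ j ih =>
    intro s cnt hj hs h7 h8 h10 ho h12 h9
    -- One step unfolds the loop, six instructions cost two each with their `seq`, and one step is
    -- the final `skip`.
    rw [show T + 1 + 14 * (j + 1) = T + 1 + 14 * j + 14 by ring]
    refine haltExp_loop_enter (by omega) ?_
    refine haltExp_seq (haltExp_op j (by simp [BinOp.eval, h9, hs.r5]) (by omega) ?_)
    refine haltExp_seq ?_
    have hd' : (0 : ℝ) < deg G u := by positivity
    refine (haltExp_rand (m := deg G u)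
      (g := fun b => A * ρ ^ j * g ^ (cnt + (1 - L.edgeQuery x (L.neighborQuery u b))) + B)
      (by simp [hs.r2]) hd ((deg_lt G u).le.trans hn.le) (fun b => by positivity) ?_).trans ?_
    · intro b _
      have hq := edgeQuery_le_one L x (L.neighborQuery u b)
      refine haltExp_seq (haltExp_neighbor (L.neighborQuery u b) (by simp [hs.r1])
        ((neighborQuery_lt L u b hn0).trans hn) ?_)
      refine haltExp_seq (haltExp_adjacent (L.edgeQuery x (L.neighborQuery u b)) (by simp [h8])
        (by omega) ?_)
      refine haltExp_seq (haltExp_op (1 - L.edgeQuery x (L.neighborQuery u b))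
        (by simp [BinOp.eval, hs.r5]) (by omega) ?_)
      refine haltExp_seq (haltExp_op (cnt + (1 - L.edgeQuery x (L.neighborQuery u b)))
        (by simp [BinOp.eval, h12]) (by omega) ?_)
      refine haltExp_skip (ih _ _ (by omega) ⟨?_, ?_, ?_, ?_, ?_, ?_⟩ ?_ ?_ ?_ ?_ ?_ ?_)
      all_goals simp [hs.r1, hs.r2, hs.r5, hs.r13, hs.r14, hs.r18, h7, h8, h10, ho]
    · apply ENNReal.ofReal_le_ofReal
      rw [L.sum_edgeQuery u x fun e => A * ρ ^ j * g ^ (cnt + (1 - e)) + B]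
      have e1 : ((missing G u x : ℝ) * (A * ρ ^ j * g ^ (cnt + (1 - 0)) + B) +
          (deg G u - missing G u x) * (A * ρ ^ j * g ^ (cnt + (1 - 1)) + B)) / deg G u =
          A * ρ ^ j * g ^ cnt * ((missing G u x : ℝ) / deg G u * g +
            (1 - (missing G u x : ℝ) / deg G u)) + B := by
        simp only [Nat.sub_zero, Nat.sub_self, Nat.add_zero, pow_succ]
        field_simp
        ring
      rw [e1]
      have : A * ρ ^ (j + 1) * g ^ cnt = A * ρ ^ j * g ^ cnt * ρ := by ring
      rw [this]
      gcongr

/-- The neighbours of `u` at position at least `i`. -/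
def AdjList.nbrsFrom (L : AdjList G) (u : Fin n) (i : ℕ) : Set (Fin n) :=
  {v | v ∈ (L.nbrs u).drop i}

theorem AdjList.nbrsFrom_zero : L.nbrsFrom u 0 = G.neighborSet u := by
  ext v
  simp [AdjList.nbrsFrom, L.mem_iff]

theorem AdjList.nbrsFrom_deg : L.nbrsFrom u (deg G u) = ∅ := by
  ext v
  simp [AdjList.nbrsFrom, ← L.length_nbrs]

/-- The loops count position `i` downwards, so the vertices already treated are those of `nbrsFrom`,
and one iteration inserts exactly one new vertex. -/
theorem AdjList.exists_nbrsFrom_eq_insert {i : ℕ} (hi : i < deg G u) :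
    ∃ x : Fin n, L.neighborQuery u i = x ∧ G.Adj u x ∧ x ∉ L.nbrsFrom u (i + 1) ∧
      L.nbrsFrom u i = insert x (L.nbrsFrom u (i + 1)) := by
  rw [← L.length_nbrs] at hi
  have h := List.drop_eq_getElem_cons hi
  refine ⟨(L.nbrs u)[i], L.neighborQuery_val u hi, (L.mem_iff u _).1 (List.getElem_mem hi), ?_, ?_⟩
  · have := (L.nodup u).sublist (List.drop_sublist i _)
    rw [h, List.nodup_cons] at this
    exact this.1
  · ext v
    simp only [AdjList.nbrsFrom, h, List.mem_cons]
    rfl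

-- Union bound as a potential: each of the `i` remaining neighbours is charged `1 / n ^ (c+1)`, plus
-- `1` if a verdict already given is wrong. The bound `r + i ≤ n` keeps the rejection counter within
-- a word.
open Classical in
theorem haltExp_loop_test {ε : ℝ} {c l : ℕ} (hε : 0 < ε) (hN1 : 1 ≤ ε * N) (hN2 : ε * N ≤ 2)
    (hl : n ≤ 2 ^ l) (ht : t = 2 * (c + 1) * l) (hm : m = 8 * N * t)
    (hmw : m < 2 ^ w) (hn : n < 2 ^ w)
    (hpost : ∀ (s : State) (r : ℕ), s.Ready G u m t → s.reg 10 = r →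
      IsLabelling (G.neighborSet u) s.out r →
      haltExp L w f T (k, s) ≤
        ENNReal.ofReal (if ∀ v ∈ G.neighborSet u, VerdictOK G u ε s.out v then 0 else 1))
    (i : ℕ) :
    ∀ (s : State) (r : ℕ), i ≤ deg G u → s.Ready G u m t → s.reg 7 = i → s.reg 10 = r →
      IsLabelling (L.nbrsFrom u i) s.out r → r + i ≤ n →
      haltExp L w f (T + 1 + (14 * m + 20) * i) (.loop 7 testBody :: k, s) ≤
        ENNReal.ofReal (i * (1 / (n : ℝ) ^ (c + 1)) +
          if ∀ v ∈ L.nbrsFrom u i, VerdictOK G u ε s.out v then 0 else 1) := by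
  have hn0 : 0 < n := u.pos
  have h1w : 1 < 2 ^ w := by omega
  induction i with
  | zero =>
    intro s r _ hs h7 h10 hlab _
    refine haltExp_loop_exit h7 ?_
    rw [AdjList.nbrsFrom_zero] at hlab ⊢
    simpa using hpost s r hs h10 hlab
  | succ i ih =>
    intro s r hi hs h7 h10 hlab hr
    obtain ⟨x, hx, hadj, hxS, hins⟩ := L.exists_nbrsFrom_eq_insert (u := u) (i := i) hi
    have hd : deg G u ≠ 0 := by omega
    have hd' : (0 : ℝ) < deg G u := by positivity
    have hmd : (missing G u x : ℝ) ≤ deg G u := by exact_mod_cast missing_le_deg u x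
    obtain ⟨A, g, ρ, hA, hg, hρ, hmean, hsmall, herr⟩ :=
      exists_exponential_bound (q := (missing G u x : ℝ) / deg G u) (c := c) hε hN1 hN2
        (by positivity) (div_le_one_of_le₀ hmd hd'.le) hl hn0
    rw [← ht, ← hm] at hsmall
    rw [← ht] at herr
    rw [show T + 1 + (14 * m + 20) * (i + 1) =
      T + 1 + (14 * m + 20) * i + 9 + 1 + 14 * m + 10 by ring]
    set b : ℝ := if ∀ v ∈ L.nbrsFrom u (i + 1), VerdictOK G u ε s.out v then 0 else 1 with hb
    have hb0 : 0 ≤ b := by rw [hb]; split_ifs <;> norm_num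
    refine haltExp_loop_enter (by omega) ?_
    refine haltExp_seq (haltExp_op i (by simp [BinOp.eval, h7, hs.r5]) (by omega) ?_)
    refine haltExp_seq (haltExp_neighbor x (by simp [hs.r1, hx]) (x.2.trans hn) ?_)
    refine haltExp_seq (haltExp_const (by omega) ?_)
    refine haltExp_seq (haltExp_op m (by simp [BinOp.eval, hs.r13, hs.r18]) hmw ?_)
    refine haltExp_seq ((haltExp_loop_sample (x := x) (i := i) (r := r) (o := s.out)
      (B := i * (1 / (n : ℝ) ^ (c + 1)) + b) (m := m) (t := t) hA hg hρ (by positivity) hmw hn hd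
      hmean ?_ m _ 0 (by omega) ⟨?_, ?_, ?_, ?_, ?_, ?_⟩ ?_ ?_ ?_ ?_ ?_ ?_).trans ?_)
    · intro s' cnt hs' h7' h8' h10' ho' h12'
      obtain ⟨a, ha⟩ : ∃ a, a = if cnt < t then 1 else 0 := ⟨_, rfl⟩
      have ha1 : a = 0 ∨ a = 1 := by
        rw [ha]
        split_ifs <;> simp
      refine haltExp_seq (haltExp_op a (by simp [BinOp.eval, h12', hs'.r14, ha]) (by omega) ?_)
      refine haltExp_seq (haltExp_label ?_)
      refine haltExp_seq (haltExp_op (1 - a) (by simp [BinOp.eval, hs'.r5]) (by omega) ?_)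
      refine haltExp_seq (haltExp_op (r + (1 - a)) (by simp [BinOp.eval, h10']) (by omega) ?_)
      have hlab' := hlab.insert hxS ha1
      rw [← hins, ← ho'] at hlab'
      refine haltExp_skip ((ih _ (r + (1 - a)) (by omega) ⟨?_, ?_, ?_, ?_, ?_, ?_⟩ ?_ ?_ ?_
        (by omega)).trans ?_)
      iterate 8 simp [hs'.r1, hs'.r2, hs'.r5, hs'.r13, hs'.r14, hs'.r18, h7']
      · simpa [h8'] using hlab'
      · apply ENNReal.ofReal_le_ofReal
        simp only [State.put_out, State.mark_out, State.put_reg, h8', ho']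
        simp only [Nat.reduceEqDiff, if_false, if_true]
        rw [add_comm (A * g ^ cnt), add_assoc]
        refine add_le_add_right ?_ _
        -- If all earlier verdicts are correct, only the new one can fail, and then `A * g ^ cnt` is
        -- at least `1`. Otherwise the whole unit has been charged through `b`.
        by_cases hgood : ∀ v ∈ L.nbrsFrom u (i + 1), VerdictOK G u ε s.out v
        · have hb' : b = 0 := by rw [hb, if_pos hgood]
          rw [hb', zero_add]
          split_ifs with hnew
          · positivity
          · apply herr
            by_contra hcon
            apply hnew
            intro v hv
            rw [hins] at hv
            rcases hv with rfl | hv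
            · rw [VerdictOK, Function.update_self]
              rw [lt_div_iff₀ hd', div_lt_iff₀ hd', not_or, not_and, not_and, not_lt, not_lt] at hcon
              by_cases hct : cnt < t
              · rw [ha, if_pos hct]
                exact ⟨fun _ => hcon.1 hct, by simp⟩
              · rw [ha, if_neg hct]
                exact ⟨by simp, fun _ => hcon.2 (not_lt.1 hct)⟩
            · have hvx : (v : ℕ) ≠ x := fun h => hxS (Fin.ext h ▸ hv)
              rw [VerdictOK, Function.update_of_ne hvx]
              exact hgood v hv
        · have hb' : b = 1 := by rw [hb, if_neg hgood]
          rw [hb']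
          refine le_trans ?_ (le_add_of_nonneg_right (by positivity))
          split_ifs <;> norm_num
    iterate 12 simp [hs.r1, hs.r2, hs.r5, hs.r13, hs.r14, hs.r18, h10]
    · apply ENNReal.ofReal_le_ofReal
      push_cast
      rw [pow_zero, mul_one]
      linarith

theorem haltExp_clear {e : ℝ≥0∞} (hn : n < 2 ^ w)
    (hpost : ∀ s : State, (∀ x : ℕ, s.out x ≠ none ↔ ∃ v ∈ closedNbhd G u, (v : ℕ) = x) →
      (∀ x i, s.out x = some i → i = 0) → haltExp L w f T (k, s) ≤ e)
    {s : State} (hs : s.Ready G u m t)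
    (hout : ∀ a : ℕ, (∀ v ∈ closedNbhd G u, (v : ℕ) ≠ a) → s.out a = none) :
    haltExp L w f (T + 7 + 8 * deg G u) (clear :: k, s) ≤ e := by
  have hn0 : 0 < n := u.pos
  have hloop : ∀ (i : ℕ) (s : State), i ≤ deg G u → s.Ready G u m t → s.reg 7 = i →
      (∀ a : ℕ, (∀ v ∈ closedNbhd G u, (v : ℕ) ≠ a) → s.out a = none) →
      (∀ v ∈ insert u (L.nbrsFrom u i), s.out (v : Fin n) = some 0) →
      haltExp L w f (T + 2 + 8 * i) (.loop 7 clearBody :: .skip :: k, s) ≤ e := by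
    intro i
    induction i with
    | zero =>
      intro s _ hs h7 hout hin
      rw [L.nbrsFrom_zero] at hin
      refine haltExp_loop_exit h7 (haltExp_skip (hpost s (fun x => ⟨fun hx => ?_, ?_⟩) ?_))
      · by_contra hcon
        push Not at hcon
        exact hx (hout x hcon)
      · rintro ⟨v, hv, rfl⟩
        simp [hin v hv]
      · intro x i hx
        by_cases hcon : ∀ v ∈ closedNbhd G u, (v : ℕ) ≠ x
        · simp [hout x hcon] at hx
        · push Not at hcon
          obtain ⟨v, hv, rfl⟩ := hcon
          rw [hin v hv] at hx
          simpa using hx.symm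
    | succ i ih =>
      intro s hi hs h7 hout hin
      obtain ⟨x, hx, hadj, hxS, hins⟩ := L.exists_nbrsFrom_eq_insert (u := u) (i := i) hi
      have := deg_lt G u
      rw [show T + 2 + 8 * (i + 1) = T + 2 + 8 * i + 8 by ring]
      refine haltExp_loop_enter (by omega) ?_
      refine haltExp_seq (haltExp_op i (by simp [BinOp.eval, h7, hs.r5]) (by omega) ?_)
      refine haltExp_seq (haltExp_neighbor x (by simp [hs.r1, hx]) (x.2.trans hn) ?_)
      refine haltExp_seq (haltExp_label ?_)
      refine haltExp_skip (ih _ (by omega) ⟨?_, ?_, ?_, ?_, ?_, ?_⟩ ?_ ?_ ?_)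
      iterate 7 simp [hs.r1, hs.r2, hs.r5, hs.r13, hs.r14, hs.r18]
      · intro a ha
        have := ha x (mem_closedNbhd_iff.2 (Or.inr hadj))
        simpa [Function.update_of_ne this.symm] using hout a ha
      · intro v hv
        by_cases hvx : v = x
        · simp [hvx, hs.r18]
        · have hvx' : (v : ℕ) ≠ x := fun h => hvx (Fin.ext h)
          simp only [State.put_out, State.mark_out, State.put_reg]
          simp only [Nat.reduceEqDiff, if_false, if_true]
          rw [Function.update_of_ne hvx']
          apply hin
          rw [hins] at hv
          rcases hv with rfl | rfl | hv
          · exact Or.inl rfl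
          · exact absurd rfl hvx
          · exact Or.inr hv
  rw [show T + 7 + 8 * deg G u = T + 2 + 8 * deg G u + 5 by ring]
  refine haltExp_seq (haltExp_label ?_)
  refine haltExp_seq (haltExp_op (deg G u) (by simp [BinOp.eval, hs.r2, hs.r18])
    ((deg_lt G u).trans hn) ?_)
  refine haltExp_seq (hloop _ _ le_rfl ⟨?_, ?_, ?_, ?_, ?_, ?_⟩ ?_ ?_ ?_)
  iterate 7 simp [hs.r1, hs.r2, hs.r5, hs.r13, hs.r14, hs.r18]
  · intro a ha
    have := ha u (mem_closedNbhd_iff.2 (Or.inl rfl))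
    simpa [hs.r1, Function.update_of_ne this.symm] using hout a ha
  · rw [L.nbrsFrom_deg]
    rintro v (rfl | hv)
    · simp [hs.r1, hs.r18]
    · exact absurd hv (Set.notMem_empty v)

-- Correct verdicts always lead to a correct output: clearing happens only when `u` is sparse, and
-- keeping only when the candidate is an almost-clique. A wrong verdict costs at most `1`.
open Classical in
theorem haltExp_finish {ε : ℝ} (hε : 0 < ε) (hε1 : ε < 1 / 64) (hN1 : 1 ≤ ε * N)
    (hN2 : ε * N ≤ 2) (hn : n < 2 ^ w) (hNn : N * n < 2 ^ w) {s : State} {r : ℕ}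
    (hs : s.Ready G u m t) (h10 : s.reg 10 = r)
    (hlab : IsLabelling (G.neighborSet u) s.out r) :
    haltExp L w (fun s => if IsLocalDecomposition G u (1 / 128) ε s.out then 0 else 1)
      (20 + 8 * deg G u) ([finish N], s) ≤
        ENNReal.ofReal (if ∀ v ∈ G.neighborSet u, VerdictOK G u ε s.out v then 0 else 1) := by
  have hn0 : 0 < n := u.pos
  have hdn := deg_lt G u
  have hr : r ≤ deg G u := by
    rw [← hlab.count, deg]
    exact Set.ncard_le_ncard (fun v hv => hv.1) (Set.toFinite _)
  have hNr : (r + 1) * N < 2 ^ w := by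
    refine lt_of_le_of_lt ?_ hNn
    rw [mul_comm]
    exact Nat.mul_le_mul_left N (by omega)
  have hNw : N < 2 ^ w := lt_of_le_of_lt (Nat.le_mul_of_pos_right N hn0) hNn
  rw [show 20 + 8 * deg G u = 0 + 1 + 7 + 8 * deg G u + 12 by ring]
  refine haltExp_seq (haltExp_label ?_)
  refine haltExp_seq (haltExp_const hNw ?_)
  refine haltExp_seq (haltExp_op (r + 1) (by simp [BinOp.eval, h10, hs.r5]) (by omega) ?_)
  refine haltExp_seq (haltExp_op ((r + 1) * N) (by simp [BinOp.eval]) hNr ?_)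
  refine haltExp_seq (haltExp_op (if deg G u < (r + 1) * N then 1 else 0)
    (by simp [BinOp.eval, hs.r2]) (by split_ifs <;> omega) ?_)
  refine haltExp_seq (haltExp_cond ?_ ?_)
  · intro hlt
    have hlt' : deg G u < (r + 1) * N := by
      by_contra hcon
      simp [hcon] at hlt
    refine haltExp_clear hn (m := m) (t := t) ?_ ⟨?_, ?_, ?_, ?_, ?_, ?_⟩ ?_
    · intro s' hl' h0'
      refine haltExp_skip ?_
      rw [haltExp_nil]
      by_cases hgood : ∀ v ∈ G.neighborSet u, VerdictOK G u ε s.out v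
      · rw [if_pos (isLocalDecomposition_zero hl' h0' ?_)]
        · exact zero_le
        · by_contra hns
          have := mul_succ_le_deg_of_not_isSparse hlab hgood hε hε1 hN2 hns
          rw [mul_comm] at this
          omega
      · rw [if_neg hgood, ENNReal.ofReal_one]
        split_ifs <;> simp
    iterate 6 simp [hs.r1, hs.r2, hs.r5, hs.r13, hs.r14, hs.r18]
    · intro a ha
      have := ha u (mem_closedNbhd_iff.2 (Or.inl rfl))
      simpa [hs.r1, Function.update_of_ne this.symm] using
        hlab.notMem a fun v hv => ha v (mem_closedNbhd_iff.2 (Or.inr hv))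
  · intro hlt
    have hlt' : N * (r + 1) ≤ deg G u := by
      by_contra hcon
      rw [mul_comm] at hcon
      simp [not_le.1 hcon] at hlt
    -- This branch halts after two `skip`s; the rest of the budget, reserved for clearing, is idle.
    rw [show 0 + 1 + 7 + 8 * deg G u = 8 * deg G u + 6 + 1 + 1 by ring]
    refine haltExp_skip (haltExp_skip ?_)
    rw [haltExp_nil]
    by_cases hgood : ∀ v ∈ G.neighborSet u, VerdictOK G u ε s.out v
    · rw [if_pos]
      · exact zero_le
      · simpa [hs.r1, hs.r5] using
          isLocalDecomposition_one (η₀ := 1 / 128) hlab hgood hε hN1 hlt'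
    · rw [if_neg hgood, ENNReal.ofReal_one]
      split_ifs <;> simp

end Program
-- Binary length of `n`, the whole program, running time and word size
section Main

variable {n : ℕ} {G : SimpleGraph (Fin n)} {L : AdjList G} {w : ℕ} {f : State → ℝ≥0∞} {T : ℕ}
  {k : List Prog} {u : Fin n}

theorem size_eq_size_half_succ {y : ℕ} (hy : y ≠ 0) : y.size = (y / 2).size + 1 := by
  conv_lhs =>
    rw [← Nat.bit_bodd_div2 y, Nat.size_bit (by rwa [Nat.bit_bodd_div2]), Nat.div2_val]

theorem haltExp_loop_digits {e : ℝ≥0∞} (y : ℕ) :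
    ∀ (s : State) (l : ℕ), s.reg 4 = y → s.reg 3 = l → s.reg 5 = 1 → s.reg 6 = 2 →
      y < 2 ^ w → l + y.size < 2 ^ w →
      (∀ s' : State, (∀ r, r ≠ 3 → r ≠ 4 → s'.reg r = s.reg r) → s'.out = s.out →
        s'.reg 3 = l + y.size → haltExp L w f T (k, s') ≤ e) →
      haltExp L w f (T + 1 + 6 * y.size) (.loop 4 digitsBody :: k, s) ≤ e := by
  induction y using Nat.strong_induction_on with
  | _ y ih =>
    intro s l h4 h3 h5 h6 hy hl hpost
    by_cases h0 : y = 0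
    · subst h0
      exact haltExp_loop_exit h4 (hpost s (fun _ _ _ => rfl) rfl (by simp [h3]))
    · have hsz := size_eq_size_half_succ h0
      have hlt : y / 2 < y := Nat.div_lt_self (Nat.pos_of_ne_zero h0) one_lt_two
      rw [hsz, show T + 1 + 6 * ((y / 2).size + 1) = T + 1 + 6 * (y / 2).size + 6 by ring]
      refine haltExp_loop_enter (by omega) ?_
      refine haltExp_seq (haltExp_op (y / 2) (by simp [BinOp.eval, h4, h6]) (by omega) ?_)
      refine haltExp_seq (haltExp_op (l + 1) (by simp [BinOp.eval, h3, h5]) (by omega) ?_)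
      refine haltExp_skip (ih _ hlt _ (l + 1) (by simp) (by simp) (by simp [h5]) (by simp [h6])
        (by omega) (by omega) ?_)
      intro s' hreg hout h3'
      refine hpost s' (fun r hr3 hr4 => ?_) hout (by omega)
      rw [hreg r hr3 hr4]
      simp [hr3, hr4]

open Classical in
theorem haltExp_localDecomposition {ε : ℝ} {N c : ℕ} (hε : 0 < ε) (hε1 : ε < 1 / 64)
    (hN1 : 1 ≤ ε * N) (hN2 : ε * N ≤ 2) (hn2 : 2 ≤ n)
    (hw : 8 * N * (2 * (c + 1)) * n < 2 ^ w) :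
    haltExp L w (fun s => if IsLocalDecomposition G u (1 / 128) ε s.out then 0 else 1)
      (44 + 6 * n.size + (14 * (8 * N * (2 * (c + 1) * n.size)) + 28) * deg G u)
      ([localDecomposition N (2 * (c + 1))], initState w n u) ≤
        ENNReal.ofReal (deg G u * (1 / (n : ℝ) ^ (c + 1))) := by
  have hN : 1 ≤ N := by
    rw [Nat.one_le_iff_ne_zero]
    rintro rfl
    norm_num at hN1
  set K := 2 * (c + 1) with hK
  have hK1 : 2 ≤ K := by omega
  have hsz : n.size ≤ n := Nat.size_le.2 Nat.lt_two_pow_self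
  have hM : 8 * N * K * n.size < 2 ^ w := (Nat.mul_le_mul_left _ hsz).trans_lt hw
  have hM' : 8 * N * K < 2 ^ w := (Nat.le_mul_of_pos_right _ (by omega)).trans_lt hw
  have hn : n < 2 ^ w := (Nat.le_mul_of_pos_left n (by positivity)).trans_lt hw
  have hKw : K < 2 ^ w := (Nat.le_mul_of_pos_left K (by positivity)).trans_lt hM'
  have hKl : K * n.size < 2 ^ w := by
    refine lt_of_le_of_lt ?_ hM
    rw [mul_assoc (8 * N)]
    exact Nat.le_mul_of_pos_left _ (by positivity)
  have hNn : N * n < 2 ^ w := by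
    refine lt_of_le_of_lt ?_ hw
    refine Nat.mul_le_mul_right n ?_
    nlinarith
  have hdn := deg_lt G u
  set d := deg G u with hd
  set m := 8 * N * (K * n.size) with hm
  have hreg : ∀ r, (initState w n u).reg r = if r = 1 then (u : ℕ) else if r = 0 then n else 0 := by
    intro r
    simp [initState, State.set, Function.update_apply, Nat.mod_eq_of_lt hn,
      Nat.mod_eq_of_lt (u.2.trans hn)]
  have hout : (initState w n u).out = fun _ => none := rfl
  rw [show 44 + 6 * n.size + (14 * m + 28) * d =
    (20 + 8 * d + 1) + 1 + (14 * m + 20) * d + 11 + 1 + 6 * n.size + 10 by ring]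
  refine haltExp_seq (haltExp_seq (haltExp_const (by omega) ?_))
  refine haltExp_seq (haltExp_const (by omega) ?_)
  refine haltExp_seq (haltExp_degree d (by simp [hreg, L.degreeQuery_val, hd]) (by omega) ?_)
  refine haltExp_seq (haltExp_op n (by simp [BinOp.eval, hreg]) hn ?_)
  refine haltExp_seq (haltExp_loop_digits n _ 0 (by simp) (by simp [hreg]) (by simp) (by simp) hn
    (by omega) ?_)
  intro s hs hso h3
  rw [zero_add] at h3
  have hs1 : s.reg 1 = u := by rw [hs 1 (by omega) (by omega)]; simp [hreg]
  have hs2 : s.reg 2 = d := by rw [hs 2 (by omega) (by omega)]; simp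
  have hs5 : s.reg 5 = 1 := by rw [hs 5 (by omega) (by omega)]; simp
  have hs10 : s.reg 10 = 0 := by rw [hs 10 (by omega) (by omega)]; simp [hreg]
  have hs18 : s.reg 18 = 0 := by rw [hs 18 (by omega) (by omega)]; simp [hreg]
  have hso' : s.out = fun _ => none := by rw [hso]; simp [hout]
  refine haltExp_seq (haltExp_const hM' ?_)
  refine haltExp_seq (haltExp_op m (by simp [BinOp.eval, h3, hm, mul_assoc])
    (by rwa [hm, ← mul_assoc]) ?_)
  refine haltExp_seq (haltExp_const hKw ?_)
  refine haltExp_seq (haltExp_op (K * n.size) (by simp [BinOp.eval, h3]) hKl ?_)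
  refine haltExp_seq (haltExp_op d (by simp [BinOp.eval, hs2, hs18]) (by omega) ?_)
  refine haltExp_seq ((haltExp_loop_test (u := u) (m := m) (t := K * n.size) (c := c)
    (l := n.size) hε hN1 hN2 (Nat.lt_size_self n).le rfl rfl (by rwa [hm, ← mul_assoc]) hn ?_
    d _ 0 le_rfl ⟨?_, ?_, ?_, ?_, ?_, ?_⟩ ?_ ?_ ?_ (by omega)).trans ?_)
  · intro s r hs' h10 hlab
    exact haltExp_skip (haltExp_finish hε hε1 hN1 hN2 hn hNn hs' h10 hlab)
  iterate 8 simp [hs1, hs2, hs5, hs10, hs18, hd]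
  · rw [hd, L.nbrsFrom_deg]
    refine ⟨fun v hv => absurd hv (Set.notMem_empty v), fun a _ => ?_, ?_⟩
    · simp [hso']
    · simp
  · rw [hd, L.nbrsFrom_deg, if_pos fun v hv => absurd hv (Set.notMem_empty v), add_zero]

theorem size_le_three_mul_log (hn : 2 ≤ n) : (n.size : ℝ) ≤ 3 * Real.log n := by
  have hpos : 0 < n.size := Nat.size_pos.2 (by omega)
  have h1 : 2 ^ (n.size - 1) ≤ n := Nat.lt_size.1 (by omega)
  have h1' : (2 : ℝ) ^ (n.size - 1) ≤ n := by exact_mod_cast h1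
  have h2 := Real.log_le_log (by positivity) h1'
  rw [Real.log_pow, Nat.cast_sub hpos, Nat.cast_one] at h2
  have h3 : Real.log 2 ≤ Real.log n := Real.log_le_log (by norm_num) (by exact_mod_cast hn)
  have h4 := Real.log_two_gt_d9
  have h5 : (0 : ℝ) ≤ n.size := Nat.cast_nonneg _
  nlinarith

/-- The running time is in fact `O((d + 1) log n / ε)`. Passing to squares uses `log n ≥ 1/2` and `ε
< 1`. -/
theorem time_bound {ε : ℝ} {N c d : ℕ} (hε : 0 < ε) (hε1 : ε < 1 / 64) (hN1 : 1 ≤ ε * N)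
    (hN2 : ε * N ≤ 2) (hn : 2 ≤ n) :
    ((44 + 6 * n.size + (14 * (8 * N * (2 * (c + 1) * n.size)) + 28) * d : ℕ) : ℝ) ≤
      6144 * (c + 1) * (d + 1) * Real.log n ^ 2 / ε ^ 2 := by
  have hl1 : 1 ≤ n.size := Nat.size_pos.2 (by omega)
  have hNR : (1 : ℝ) ≤ N := by
    have : (0 : ℝ) ≤ N := Nat.cast_nonneg N
    nlinarith
  have hN : 1 ≤ N := by exact_mod_cast hNR
  have h1 : 44 + 6 * n.size + (14 * (8 * N * (2 * (c + 1) * n.size)) + 28) * d ≤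
      512 * (c + 1) * (d + 1) * (N * n.size) := by
    have ha : n.size ≤ N * n.size := Nat.le_mul_of_pos_left _ hN
    have hb : N * n.size ≤ (c + 1) * (N * n.size) := Nat.le_mul_of_pos_left _ (by omega)
    generalize hq : (c + 1) * (N * n.size) = q at hb
    have e1 : 8 * N * (2 * (c + 1) * n.size) = 16 * q := by rw [← hq]; ring
    have e2 : 512 * (c + 1) * (d + 1) * (N * n.size) = 512 * (d + 1) * q := by rw [← hq]; ring
    rw [e1, e2]
    have : 1 ≤ q := by omega
    nlinarith
  have h2 : ((44 + 6 * n.size + (14 * (8 * N * (2 * (c + 1) * n.size)) + 28) * d : ℕ) : ℝ) ≤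
      512 * (c + 1) * (d + 1) * (N * n.size) := by exact_mod_cast h1
  refine h2.trans ?_
  have hlog : 1 / 2 ≤ Real.log n := by
    have h3 : Real.log 2 ≤ Real.log n := Real.log_le_log (by norm_num) (by exact_mod_cast hn)
    have := Real.log_two_gt_d9
    linarith
  have hsz : (n.size : ℝ) ≤ 6 * Real.log n ^ 2 := by
    have := size_le_three_mul_log hn
    nlinarith
  have hNε : (N : ℝ) ≤ 2 / ε ^ 2 := by
    rw [le_div_iff₀ (by positivity)]
    nlinarith
  calc (512 : ℝ) * (c + 1) * (d + 1) * (N * n.size)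
      ≤ 512 * (c + 1) * (d + 1) * (2 / ε ^ 2 * (6 * Real.log n ^ 2)) := by gcongr
    _ = 6144 * (c + 1) * (d + 1) * Real.log n ^ 2 / ε ^ 2 := by ring

/-- Words of `κ log (n / ε)` bits hold all numbers the algorithm computes. -/
theorem lt_two_pow_of_logb_le {ε : ℝ} {N K : ℕ} (hε : 0 < ε) (hε1 : ε < 1 / 64)
    (hN2 : ε * N ≤ 2) (hn : 2 ≤ n)
    (hw : ((K + 2 : ℕ) : ℝ) * Real.logb 2 (n / ε) ≤ w) : 8 * N * K * n < 2 ^ w := by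
  have hn' : (2 : ℝ) ≤ n := by exact_mod_cast hn
  set q : ℝ := n / ε with hq
  have hq1 : 128 ≤ q := by
    rw [hq, le_div_iff₀ hε]
    linarith
  have h1 : q ^ (K + 2) ≤ 2 ^ w := by
    rw [← Real.logb_pow, Real.logb_le_iff_le_rpow one_lt_two (by positivity),
      Real.rpow_natCast] at hw
    exact hw
  have h2 : (8 * N * K * n : ℝ) ≤ 16 * K * q := by
    rw [hq, mul_div_assoc', le_div_iff₀ hε]
    have : (0 : ℝ) ≤ K * n := by positivity
    nlinarith
  have h3 : (K : ℝ) < 2 ^ K := by exact_mod_cast Nat.lt_two_pow_self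
  have h4 : (8 * N * K * n : ℝ) < 2 ^ w := by
    refine h2.trans_lt (lt_of_lt_of_le ?_ h1)
    -- As `q = n / ε ≥ 128`, one factor `q` pays for `16` and `q ^ K` for `2 ^ K`; hence the
    -- exponent `K + 2`.
    calc 16 * (K : ℝ) * q < 16 * 2 ^ K * q := by gcongr
      _ ≤ q * q ^ K * q := by
        gcongr <;> linarith
      _ = q ^ (K + 2) := by ring
  exact_mod_cast h4

end Main
end SDD

theorem mainTheorem4 :
    ∃ η₀ : ℝ, 0 < η₀ ∧ η₀ ≤ 1 ∧
      -- success probability at least `1 - n ^ (-c)`, for an arbitrary exponent `c`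
      ∀ c : ℕ, ∃ (C : ℝ) (κ : ℕ),
        ∀ ε : ℝ, 0 < ε → ε < 1 / 64 →
          ∃ P : SDD.Prog,
            ∀ (n : ℕ), 2 ≤ n →
              ∀ (G : SimpleGraph (Fin n)) (L : SDD.AdjList G) (u : Fin n)
                -- words of `O(log (n / ε))` bits
                (w : ℕ), (κ : ℝ) * Real.logb 2 ((n : ℝ) / ε) ≤ (w : ℝ) →
                ∃ T : ℕ,
                  (T : ℝ) ≤ C * ((SDD.closedNbhd G u).ncard : ℝ) * Real.log n ^ 2 / ε ^ 2 ∧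
                  -- every run halts within `T` steps
                  (∀ x ∈ (SDD.run L w T ([P], SDD.initState w n u)).support, x.1 = []) ∧
                  -- the output is wrong with probability at most `n ^ (-c)`
                  (SDD.run L w T ([P], SDD.initState w n u)).toOuterMeasure
                      {x | ¬ SDD.IsLocalDecomposition G u η₀ ε x.2.out} ≤
                    ((n : ENNReal) ^ c)⁻¹ := by
  classical
  refine ⟨1 / 128, by norm_num, by norm_num, fun c => ⟨6144 * (c + 1), 2 * (c + 1) + 2,
    fun ε hε hε1 => ⟨SDD.localDecomposition ⌈1 / ε⌉₊ (2 * (c + 1)), fun n hn G L u w hw => ?_⟩⟩⟩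
  set N := ⌈1 / ε⌉₊ with hN
  have hN1 : 1 ≤ ε * N := by
    have := Nat.le_ceil (1 / ε)
    rwa [div_le_iff₀' hε] at this
  have hN2 : ε * N ≤ 2 := by
    have := Nat.ceil_lt_add_one (a := 1 / ε) (by positivity)
    rw [← hN] at this
    have h2 : ε * N ≤ ε * (1 / ε + 1) := mul_le_mul_of_nonneg_left this.le hε.le
    rw [mul_add, mul_one_div_cancel hε.ne'] at h2
    linarith
  have key := SDD.haltExp_localDecomposition (L := L) (u := u) hε hε1 hN1 hN2 hn
    (SDD.lt_two_pow_of_logb_le hε hε1 hN2 hn hw)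
  refine ⟨_, ?_, fun x hx => SDD.halted_of_haltExp_ne_top (ne_top_of_le_ne_top
    ENNReal.ofReal_ne_top key) hx,
    (SDD.toOuterMeasure_le_haltExp _ fun s => SDD.IsLocalDecomposition G u (1 / 128) ε s.out).trans
      (key.trans ?_)⟩
  · rw [SDD.ncard_closedNbhd, Nat.cast_succ]
    exact SDD.time_bound hε hε1 hN1 hN2 hn
  · have hn0 : (0 : ℝ) < n := by exact_mod_cast (by omega : 0 < n)
    have hdn : (SDD.deg G u : ℝ) ≤ n := by exact_mod_cast (SDD.deg_lt G u).le
    -- The spare factor `1 / n` in the error per neighbour pays for the union over at most `n`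
    -- neighbours.
    have h1 : (SDD.deg G u : ℝ) * (1 / (n : ℝ) ^ (c + 1)) ≤ ((n : ℝ) ^ c)⁻¹ := by
      rw [mul_one_div, div_le_iff₀ (by positivity), pow_succ, inv_mul_cancel_left₀ (by positivity)]
      exact hdn
    refine (ENNReal.ofReal_le_ofReal h1).trans ?_
    rw [ENNReal.ofReal_inv_of_pos (by positivity), ENNReal.ofReal_pow hn0.le,
      ENNReal.ofReal_natCast]
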